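/- Let $N\ge 0$ and $d_1,\dots,d_N\ge 0$ be integers, let $\mathbb{S}^{d}=\{x\in\mathbb{R}^{d+1} : \|x\|=1\}$, and let $\mathcal{M}=\mathbb{S}^{d_1}\times\cdots\times\mathbb{S}^{d_N}$ be the product of spheres, with the Riemannian submanifold metric inherited from $\mathcal{E}=\mathbb{R}^{d_1+1}\times\cdots\times\mathbb{R}^{d_N+1}$. Let $\mathrm{R}$ be the metric projection retraction of $\mathcal{M}$, that is, for $x\in\mathcal{M}$ and $v\in\mathrm{T}_x\mathcal{M}$, $$\mathrm{R}_x(v)=\Big(\frac{x_1+v_1}{\|x_1+v_1\|},\dots,\frac{x_N+v_N}{\|x_N+v_N\|}\Big).$$ Let $f\colon\mathcal{M}\to\mathbb{R}$ be $C^2$, with Riemannian gradient $\mathrm{grad} f$ and Riemannian Hessian $\mathrm{Hess} f$, and assume that $\mathrm{grad} f$ is $L$-Lipschitz continuous for some $L>0$, meaning that $\|\mathrm{Hess} f(x)[u]\|\le L\|u\|$ for all $x\in\mathcal{M}$ and $u\in\mathrm{T}_x\mathcal{M}$. Let $0<\alpha<1/L$. Then Riemannian gradient descent $$x_{t+1}=g(x_t),\qquad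 g(x)=\mathrm{R}_x(-\alpha\,\mathrm{grad} f(x)),$$ avoids the strict saddles of $f$: the set of initial points $x_0\in\mathcal{M}$ for which the sequence $g^t(x_0)$ converges to a strict saddle of $f$ has measure zero in $\mathcal{M}$. Here a strict saddle is a point $x^*\in\mathcal{M}$ such that $\mathrm{grad} f(x^*)=0$ and $\mathrm{Hess} f(x^*)$ has a negative eigenvalue, and a set $A\subseteq\mathcal{M}$ has measure zero if $\varphi(A\cap U)$ has Lebesgue measure zero for every smooth chart $(U,\varphi)$ of $\mathcal{M}$. -/

import Mathlib

open scoped Manifold ContDiff Topology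

noncomputable section

/-- The product of spheres `S^{d_1} × ⋯ × S^{d_N}`, where `S^k` is the unit sphere of `ℝ^{k+1}`
with Mathlib's topology and atlas (stereographic charts), and the product topology and atlas. -/
abbrev ProductSphere {N : ℕ} (d : Fin N → ℕ) : Type :=
  ∀ i : Fin N, Metric.sphere (0 : EuclideanSpace ℝ (Fin (d i + 1))) 1

namespace ProductSphere

variable {N : ℕ} {d : Fin N → ℕ}

/-- The Euclidean space `ℝ^{d_1+1} × ⋯ × ℝ^{d_N+1}` with the Euclidean norm. -/
abbrev Ambient (d : Fin N → ℕ) : Type :=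
  PiLp 2 (fun i : Fin N => EuclideanSpace ℝ (Fin (d i + 1)))

/-- The inclusion of the product of spheres in its ambient Euclidean space. -/
def incl (x : ProductSphere d) : Ambient d :=
  WithLp.toLp 2 (fun i => (x i : EuclideanSpace ℝ (Fin (d i + 1))))

/-- The model with corners of the product of spheres, on `ℝ^{d_1} × ⋯ × ℝ^{d_N}`. -/
abbrev model (d : Fin N → ℕ) :
    ModelWithCorners ℝ (∀ i : Fin N, EuclideanSpace ℝ (Fin (d i)))
      (ModelPi (fun i : Fin N => EuclideanSpace ℝ (Fin (d i)))) :=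
  ModelWithCorners.pi (fun i : Fin N => 𝓡 (d i))

/-- The product of spheres, with the product atlas, is a smooth manifold. -/
instance isManifold : IsManifold (model d) ∞ (ProductSphere d) := by
  refine isManifold_of_contDiffOn (model d) ∞ (ProductSphere d) ?_
  rintro e e' ⟨s, hs, rfl⟩ ⟨s', hs', rfl⟩
  refine contDiffOn_pi.2 fun i => ?_
  have h : (s i).symm ≫ₕ s' i ∈ contDiffGroupoid ∞ (𝓡 (d i)) :=
    HasGroupoid.compatible (hs i trivial) (hs' i trivial)
  have h1 := (mem_groupoid_of_pregroupoid.1 h).1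
  have hp : ContDiff ℝ ∞ (fun y : ∀ j, EuclideanSpace ℝ (Fin (d j)) => y i) :=
    contDiff_pi.1 contDiff_id i
  refine ContDiffOn.comp (f := fun y : ∀ j, EuclideanSpace ℝ (Fin (d j)) => y i) h1
    hp.contDiffOn ?_
  rintro y ⟨hy, -⟩
  refine ⟨⟨hy.1 i trivial, hy.2 i trivial⟩, ?_⟩
  simp

/-- The tangent space of the product of spheres at `x`, as a subspace of the ambient space:
the vectors whose `i`-th component is orthogonal to `x_i` for every `i`.
It carries the inner product of the ambient space (the submanifold metric). -/
def tangent (x : ProductSphere d) : Submodule ℝ (Ambient d) where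
  carrier := {u | ∀ i, inner ℝ (x i : EuclideanSpace ℝ (Fin (d i + 1))) (u i) = 0}
  add_mem' := by
    intro u v hu hv i
    simp [inner_add_right, hu i, hv i]
  zero_mem' := by
    intro i
    simp
  smul_mem' := by
    intro c u hu i
    simp [inner_smul_right, hu i]

theorem one_le_norm_add (x : ProductSphere d) (v : tangent x) (i : Fin N) :
    1 ≤ ‖(x i : EuclideanSpace ℝ (Fin (d i + 1))) + (v : Ambient d) i‖ := by
  have h := norm_add_sq_eq_norm_sq_add_norm_sq_of_inner_eq_zero _ _ (v.2 i)
  have hx : ‖(x i : EuclideanSpace ℝ (Fin (d i + 1)))‖ = 1 := norm_eq_of_mem_sphere (x i)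
  rw [hx] at h
  nlinarith [norm_nonneg ((x i : EuclideanSpace ℝ (Fin (d i + 1))) + (v : Ambient d) i),
    mul_self_nonneg ‖(v : Ambient d) i‖]

/-- The retraction `R_x(v) = (x + v) / ‖x + v‖`, componentwise, for `v` tangent at `x`. -/
def retr (x : ProductSphere d) (v : tangent x) : ProductSphere d := fun i =>
  ⟨‖(x i : EuclideanSpace ℝ (Fin (d i + 1))) + (v : Ambient d) i‖⁻¹ •
      ((x i : EuclideanSpace ℝ (Fin (d i + 1))) + (v : Ambient d) i), by
    have h : ‖(x i : EuclideanSpace ℝ (Fin (d i + 1))) + (v : Ambient d) i‖ ≠ 0 :=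
      (lt_of_lt_of_le one_pos (one_le_norm_add x v i)).ne'
    rw [mem_sphere_zero_iff_norm, norm_smul, norm_inv, norm_norm, inv_mul_cancel₀ h]⟩

/-- `R_x(v)` is the metric projection of `x + v`: the unique point of the product of spheres
closest to `x + v`. -/
theorem dist_retr_lt (x : ProductSphere d) (v : tangent x) (z : ProductSphere d)
    (hz : z ≠ retr x v) :
    dist (incl (retr x v)) (incl x + v) < dist (incl z) (incl x + v) := by
  have key : ∀ i, ∀ w : Metric.sphere (0 : EuclideanSpace ℝ (Fin (d i + 1))) 1,
      dist (w : EuclideanSpace ℝ (Fin (d i + 1)))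
          ((x i : EuclideanSpace ℝ (Fin (d i + 1))) + (v : Ambient d) i) ^ 2 =
        dist (retr x v i : EuclideanSpace ℝ (Fin (d i + 1)))
          ((x i : EuclideanSpace ℝ (Fin (d i + 1))) + (v : Ambient d) i) ^ 2 +
        ‖(x i : EuclideanSpace ℝ (Fin (d i + 1))) + (v : Ambient d) i‖ *
          dist (w : EuclideanSpace ℝ (Fin (d i + 1))) (retr x v i) ^ 2 := by
    intro i w
    have hρ := one_le_norm_add x v i
    have hr : (retr x v i : EuclideanSpace ℝ (Fin (d i + 1))) =
        ‖(x i : EuclideanSpace ℝ (Fin (d i + 1))) + (v : Ambient d) i‖⁻¹ •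
          ((x i : EuclideanSpace ℝ (Fin (d i + 1))) + (v : Ambient d) i) := rfl
    have hy : (x i : EuclideanSpace ℝ (Fin (d i + 1))) + (v : Ambient d) i =
        ‖(x i : EuclideanSpace ℝ (Fin (d i + 1))) + (v : Ambient d) i‖ •
          (retr x v i : EuclideanSpace ℝ (Fin (d i + 1))) := by
      rw [hr, smul_smul, mul_inv_cancel₀ (by positivity), one_smul]
    have h1 : ‖(retr x v i : EuclideanSpace ℝ (Fin (d i + 1)))‖ = 1 :=
      norm_eq_of_mem_sphere (retr x v i)
    have h2 : ‖(w : EuclideanSpace ℝ (Fin (d i + 1)))‖ = 1 := norm_eq_of_mem_sphere w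
    generalize ‖(x i : EuclideanSpace ℝ (Fin (d i + 1))) + (v : Ambient d) i‖ = ρ at *
    rw [hy]
    simp only [dist_eq_norm, norm_sub_sq_real, inner_smul_right, norm_smul, h1, h2,
      real_inner_self_eq_norm_sq]
    ring
  rw [PiLp.dist_eq_of_L2, PiLp.dist_eq_of_L2]
  refine Real.sqrt_lt_sqrt (Finset.sum_nonneg fun i _ => sq_nonneg _) ?_
  obtain ⟨j, hj⟩ := Function.ne_iff.1 hz
  refine Finset.sum_lt_sum (fun i _ => ?_) ⟨j, Finset.mem_univ j, ?_⟩
  · have := key i (z i)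
    have hp := one_le_norm_add x v i
    simp only [incl, PiLp.add_apply] at this ⊢
    rw [this]
    exact le_add_of_nonneg_right (by positivity)
  · have := key j (z j)
    have hp := one_le_norm_add x v j
    have hd : 0 < dist (z j : EuclideanSpace ℝ (Fin (d j + 1))) (retr x v j) :=
      dist_pos.2 fun h => hj (Subtype.ext h)
    simp only [incl, PiLp.add_apply] at this ⊢
    rw [this]
    exact lt_add_of_pos_right _ (by positivity)

theorem retr_zero (x : ProductSphere d) : retr x 0 = x := by
  funext i
  apply Subtype.ext
  have hx : ‖(x i : EuclideanSpace ℝ (Fin (d i + 1)))‖ = 1 := norm_eq_of_mem_sphere (x i)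
  simp [retr, hx]

/-- The differential of `R_x` at `0` is the identity of the tangent space. -/
theorem hasFDerivAt_retr (x : ProductSphere d) :
    HasFDerivAt (fun v : tangent x => incl (retr x v)) (tangent x).subtypeL 0 := by
  rw [← hasFDerivWithinAt_univ, hasFDerivWithinAt_piLp]
  intro i
  let p : tangent x →L[ℝ] EuclideanSpace ℝ (Fin (d i + 1)) :=
    (PiLp.proj 2 (fun i : Fin N => EuclideanSpace ℝ (Fin (d i + 1))) i).comp (tangent x).subtypeL
  have hx : ‖(x i : EuclideanSpace ℝ (Fin (d i + 1)))‖ = 1 := norm_eq_of_mem_sphere (x i)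
  have hn : ∀ v : tangent x,
      ‖(x i : EuclideanSpace ℝ (Fin (d i + 1))) + (v : Ambient d) i‖ = √(1 + ‖p v‖ ^ 2) := by
    intro v
    have h := norm_add_sq_eq_norm_sq_add_norm_sq_of_inner_eq_zero _ _ (v.2 i)
    rw [hx] at h
    symm
    rw [Real.sqrt_eq_iff_mul_self_eq (by positivity) (norm_nonneg _), h, sq, one_mul]
    rfl
  have h0 : HasFDerivAt (fun v : tangent x => 1 + ‖p v‖ ^ 2) (0 : tangent x →L[ℝ] ℝ) 0 := by
    have := (p.hasFDerivAt (x := 0)).norm_sq.const_add 1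
    refine this.congr_fderiv ?_
    ext v
    simp
  have h1 : HasFDerivAt (fun v : tangent x => (√(1 + ‖p v‖ ^ 2))⁻¹) (0 : tangent x →L[ℝ] ℝ) 0 := by
    have := (hasDerivAt_inv (x := √(1 + ‖p 0‖ ^ 2)) (by simp)).comp_hasFDerivAt 0
      (h0.sqrt (by simp))
    refine this.congr_fderiv ?_
    simp
  have h2 := h1.smul ((p.hasFDerivAt (x := 0)).const_add
    (x i : EuclideanSpace ℝ (Fin (d i + 1))))
  rw [hasFDerivWithinAt_univ]
  refine (h2.congr_fderiv ?_).congr_of_eventuallyEq (Filter.Eventually.of_forall fun v => ?_)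
  · ext v
    simp [p]
  · simp only [incl, retr, hn v]
    rfl

/-- The Riemannian gradient of `f` at `x` for the submanifold metric: the tangent vector
representing `Df(x)`. Since `R_x(0) = x` and `DR_x(0)` is the identity,
`Df(x)[u] = D(f ∘ R_x)(0)[u]` for every tangent vector `u`. -/
def grad (f : ProductSphere d → ℝ) (x : ProductSphere d) : tangent x :=
  gradient (fun v : tangent x => f (retr x v)) 0

/-- The Riemannian Hessian of `f` at `x` for the submanifold metric:
`Hess f(x)[u] = Proj_x (D grad f(x)[u])`, where `grad f` is differentiated as a map into the ambient
space and `Proj_x` is the orthogonal projection onto the tangent space at `x`. As in `grad`,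
the differential at `x` is computed through `R_x`. -/
def hess (f : ProductSphere d → ℝ) (x : ProductSphere d) : tangent x →L[ℝ] tangent x :=
  (tangent x).orthogonalProjectionOnto ∘L
    fderiv ℝ (fun v : tangent x => (grad f (retr x v) : Ambient d)) 0

/-- `grad f` is `L`-Lipschitz continuous, for `f` of class `C^2`:
`‖Hess f(x)[u]‖ ≤ L ‖u‖` for all `x` and all tangent `u` at `x`. -/
def GradLipschitz (f : ProductSphere d → ℝ) (L : ℝ) : Prop :=
  ∀ (x : ProductSphere d) (u : tangent x), ‖hess f x u‖ ≤ L * ‖u‖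

/-- A strict saddle of `f`: a critical point at which the Riemannian Hessian has a negative
eigenvalue. -/
def IsStrictSaddle (f : ProductSphere d → ℝ) (x : ProductSphere d) : Prop :=
  grad f x = 0 ∧ ∃ c : ℝ, c < 0 ∧
    Module.End.HasEigenvalue (hess f x : tangent x →ₗ[ℝ] tangent x) c

/-- The iteration map `g(x) = R_x(-α grad f(x))` of Riemannian gradient descent with step size `α`
and the metric projection retraction. -/
def rgd (f : ProductSphere d → ℝ) (α : ℝ) (x : ProductSphere d) : ProductSphere d :=
  retr x (-(α • grad f x))

/-- A subset of the product of spheres has measure zero if its image in every smooth chart is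
Lebesgue-null. -/
def MeasureZero (A : Set (ProductSphere d)) : Prop :=
  ∀ φ ∈ IsManifold.maximalAtlas (model d) ∞ (ProductSphere d),
    MeasureTheory.volume (φ.extend (model d) '' (A ∩ φ.source)) = 0

/-- The system `x_{t+1} = g(x_t)` avoids `S`: the set of initial points from which it converges to
a point of `S` has measure zero. -/
def Avoids (g : ProductSphere d → ProductSphere d) (S : Set (ProductSphere d)) : Prop :=
  MeasureZero {x₀ | ∃ x ∈ S, Filter.Tendsto (fun t : ℕ => g^[t] x₀) Filter.atTop (𝓝 x)}

end ProductSphere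

end

/-! Everything is lifted to the ambient space: a set `A` of the product of spheres is replaced by
the cone over it, which is null only if `A` is (`measureZero_of_measure_cone_eq_zero`). Two lifts of
the iteration are used. They agree up to positive scaling of the components.

The lift `step` has injective derivative wherever no component vanishes (`fderiv_step_injective`).
The curvature of the spheres contributes a term of favourable sign, so `α * L < 1` suffices even far
from critical points. Hence preimages of null cones are null.

The lift `rgdExt` preserves the norms of the components. At a critical point its derivative is the
identity minus `α` times an extension of the Hessian: symmetric, nonnegative, and with an eigenvalue
above `1` at a strict saddle. No stable manifold is needed to see that almost every orbit leaves
(`exists_nhds_measure_forall_iterate_mem_eq_zero`): an indefinite quadratic form `Q` of the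
difference of two orbits, once positive, grows geometrically. So two trapped points satisfy `Q (y -
z) ≤ 0`, and a set with this property has infinitely many disjoint translates, all by bounded
vectors, hence is null.

Countably many of the resulting neighbourhoods cover the strict saddles. An orbit converging to a
saddle is eventually trapped in one of them, so its initial point lies in an iterated preimage of a
null set. -/

noncomputable section

/-! ### Trapped orbits and null preimages in a Euclidean space -/

section Analysis

open MeasureTheory Set Filter

variable {E : Type*} [NormedAddCommGroup E] [InnerProductSpace ℝ E] [FiniteDimensional ℝ E]
  [MeasurableSpace E] [BorelSpace E] (μ : Measure E) [μ.IsAddHaarMeasure]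

/-- A set none of whose differences lies in an open cone around `e` is null. -/
theorem measure_eq_zero_of_sub_nonpos {Q : E → ℝ} (hQ : Continuous Q) {e : E}
    (he : ∀ t : ℝ, t ≠ 0 → 0 < Q (t • e)) {W : Set E}
    (hW : ∀ x ∈ W, ∀ y ∈ W, Q (y - x) ≤ 0) : μ W = 0 := by
  -- The condition is closed, so it passes to the closure, which is measurable.
  have hcl : ∀ x ∈ closure W, ∀ y ∈ closure W, Q (y - x) ≤ 0 := by
    intro x hx y hy
    have hc : IsClosed {p : E × E | Q (p.2 - p.1) ≤ 0} :=
      isClosed_le (hQ.comp (continuous_snd.sub continuous_fst)) continuous_const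
    have : (x, y) ∈ closure (W ×ˢ W) := by rw [closure_prod_eq]; exact ⟨hx, hy⟩
    exact closure_minimal (fun p hp => hW p.1 hp.1 p.2 hp.2) hc this
  refine measure_mono_null subset_closure
    (Measure.addHaar_eq_zero_of_disjoint_translates μ (fun n : ℕ => (1 / ((n : ℝ) + 1)) • e)
      ?_ ?_ isClosed_closure.measurableSet)
  · exact Metric.isBounded_range_of_tendsto _
      (tendsto_one_div_add_atTop_nhds_zero_nat.smul_const e)
  · intro m n hmn
    refine Set.disjoint_left.2 fun z hz hz' => ?_
    simp only [singleton_add, image_add_left, mem_preimage] at hz hz'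
    have h := hcl _ hz _ hz'
    have hne : 1 / ((m : ℝ) + 1) - 1 / ((n : ℝ) + 1) ≠ 0 := by
      intro h0
      apply hmn
      have := sub_eq_zero.1 h0
      rw [one_div, one_div, inv_inj] at this
      exact_mod_cast add_right_cancel this
    have h2 := he _ hne
    rw [sub_smul] at h2
    have h3 : -((1 / ((n : ℝ) + 1)) • e) + z - (-((1 / ((m : ℝ) + 1)) • e) + z)
        = (1 / ((m : ℝ) + 1)) • e - (1 / ((n : ℝ) + 1)) • e := by abel
    rw [h3] at h
    exact absurd h2 (not_lt.2 h)

/-- Near a point where the derivative is symmetric, nonnegative and has an eigenvalue larger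
than `1`, almost every orbit leaves. -/
theorem exists_nhds_measure_forall_iterate_mem_eq_zero {g : E → E} {A : E →L[ℝ] E} {x : E}
    (hg : HasStrictFDerivAt g A x) (hA : (A : E →ₗ[ℝ] E).IsSymmetric)
    (hA0 : ∀ u, 0 ≤ inner ℝ (A u) u) {m : ℝ} (hm : 1 < m) {e : E} (he : e ≠ 0)
    (hAe : A e = m • e) :
    ∃ U ∈ 𝓝 x, μ {z | ∀ t, g^[t] z ∈ U} = 0 := by
  -- `κ > 1` gives growth, `κ < m` keeps `Q` positive along `e`, and avoiding the spectrum makes `B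
  -- = A - κ` injective.
  obtain ⟨κ, ⟨hκ1, hκm⟩, hκ⟩ : ∃ κ ∈ Ioo 1 m, ¬ Module.End.HasEigenvalue (A : E →ₗ[ℝ] E) κ := by
    have hfin : {κ : ℝ | Module.End.HasEigenvalue (A : E →ₗ[ℝ] E) κ}.Finite :=
      Module.End.finite_hasEigenvalue (A : E →ₗ[ℝ] E)
    obtain ⟨κ, h1, h2⟩ := (Ioo_infinite hm).exists_notMem_finite hfin
    exact ⟨κ, h1, h2⟩
  set B : E →L[ℝ] E := A - κ • ContinuousLinearMap.id ℝ E with hB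
  have hBu : ∀ u, B u = A u - κ • u := fun u => by simp [hB]
  have hBsymm : ∀ u v, inner ℝ (B u) v = inner ℝ u (B v) := by
    intro u v
    have := hA u v
    simp only [ContinuousLinearMap.coe_coe] at this
    simp only [hBu, inner_sub_left, inner_sub_right, inner_smul_left, inner_smul_right, this]
    simp
  have hBker : LinearMap.ker (B : E →ₗ[ℝ] E) = ⊥ := by
    rw [LinearMap.ker_eq_bot']
    intro u hu
    by_contra hu0
    refine hκ (Module.End.hasEigenvalue_of_hasEigenvector (x := u) ?_)
    refine Module.End.hasEigenvector_iff.2 ⟨Module.End.mem_eigenspace_iff.2 ?_, hu0⟩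
    have : B u = 0 := hu
    rw [hBu, sub_eq_zero] at this
    exact this
  obtain ⟨K, hK0, hK⟩ := LinearMap.exists_antilipschitzWith (B : E →ₗ[ℝ] E) hBker
  set Q : E → ℝ := fun w => inner ℝ (B w) w with hQ
  have hQc : Continuous Q := B.continuous.inner continuous_id
  -- With `A = B + κ`, `Q (A w) = ⟪B (B w), B w⟫ + 2 κ ‖B w‖² + κ² Q w`, and `⟪A (B w), B w⟫ ≥ 0`
  -- bounds the cubic term below by `-κ ‖B w‖²`.
  have key : ∀ w, κ ^ 2 * Q w + κ * ‖B w‖ ^ 2 ≤ Q (A w) := by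
    intro w
    have h0 := hA0 (B w)
    have e1 : A w = B w + κ • w := by rw [hBu]; abel
    have e2 : A (B w) = B (B w) + κ • B w := by rw [hBu (B w)]; abel
    have h1 := hBsymm (B w) w
    rw [e2] at h0
    simp only [hQ, e1, map_add, map_smul, inner_add_left, inner_add_right, inner_smul_left,
      inner_smul_right, real_inner_self_eq_norm_sq] at h0 ⊢
    simp only [conj_trivial] at h0 ⊢
    rw [h1, real_inner_self_eq_norm_sq]
    nlinarith
  -- the perturbation
  obtain ⟨ε, hε0, hε1, hε⟩ : ∃ ε : ℝ, 0 < ε ∧ ε ≤ 1 ∧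
      ∀ w r : E, ‖r‖ ≤ ε * ‖w‖ → κ ^ 2 * Q w ≤ Q (A w + r) := by
    have hKp : (0 : ℝ) < K := hK0
    -- The perturbation costs at most `ε * C * ‖w‖²`, against the gain `κ ‖B w‖² ≥ κ / K² * ‖w‖²`.
    -- The bound `ε ≤ 1` makes the term quadratic in `r` linear in `ε`.
    set C : ℝ := 2 * ‖B‖ * ‖A‖ + ‖B‖ + 1 with hC
    have hCp : 0 < C := by positivity
    refine ⟨min 1 (κ / (K ^ 2 * C)), lt_min one_pos (by positivity), min_le_left _ _, ?_⟩
    intro w r hr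
    set ε := min 1 (κ / (K ^ 2 * C))
    have hε0 : 0 < ε := lt_min one_pos (by positivity)
    have hε1 : ε ≤ 1 := min_le_left _ _
    have hε2 : ε * C ≤ κ / K ^ 2 := by
      have : ε ≤ κ / (K ^ 2 * C) := min_le_right _ _
      calc ε * C ≤ κ / (K ^ 2 * C) * C := by gcongr
        _ = κ / K ^ 2 := by field_simp
    have hw : ‖w‖ ≤ K * ‖B w‖ := by
      have := hK.le_mul_dist w 0
      simpa using this
    have hw2 : κ / K ^ 2 * ‖w‖ ^ 2 ≤ κ * ‖B w‖ ^ 2 := by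
      have : ‖w‖ ^ 2 ≤ (K * ‖B w‖) ^ 2 := by gcongr
      calc κ / K ^ 2 * ‖w‖ ^ 2 ≤ κ / K ^ 2 * (K * ‖B w‖) ^ 2 := by gcongr
        _ = κ * ‖B w‖ ^ 2 := by field_simp
    have hexp : Q (A w + r) = Q (A w) + 2 * inner ℝ (B (A w)) r + inner ℝ (B r) r := by
      have := hBsymm r (A w)
      simp only [hQ, map_add, inner_add_left, inner_add_right]
      rw [this, real_inner_comm (B (A w)) r]
      ring
    have b1 : |inner ℝ (B (A w)) r| ≤ ‖B‖ * ‖A‖ * ‖w‖ * (ε * ‖w‖) := by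
      refine (abs_real_inner_le_norm _ _).trans ?_
      have : ‖B (A w)‖ ≤ ‖B‖ * ‖A‖ * ‖w‖ := by
        rw [mul_assoc]
        exact (B.le_opNorm _).trans (by gcongr; exact A.le_opNorm _)
      gcongr
    have b2 : |inner ℝ (B r) r| ≤ ‖B‖ * (ε * ‖w‖) * ‖w‖ := by
      refine (abs_real_inner_le_norm _ _).trans ?_
      have h1 : ‖B r‖ ≤ ‖B‖ * (ε * ‖w‖) := (B.le_opNorm _).trans (by gcongr)
      have h2 : ‖r‖ ≤ ‖w‖ := hr.trans (mul_le_of_le_one_left (norm_nonneg _) hε1)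
      gcongr
    have hk := key w
    have c1 := (abs_le.1 b1).1
    have c2 := (abs_le.1 b2).1
    have : ε * C * ‖w‖ ^ 2 ≤ κ / K ^ 2 * ‖w‖ ^ 2 := by gcongr
    have hx : 0 ≤ ε * ‖w‖ ^ 2 := by positivity
    rw [hexp]
    have : ε * C * ‖w‖ ^ 2 = 2 * (‖B‖ * ‖A‖ * ‖w‖ * (ε * ‖w‖)) + ‖B‖ * (ε * ‖w‖) * ‖w‖
      + ε * ‖w‖ ^ 2 := by rw [hC]; ring
    linarith
  -- Strict differentiability bounds the remainder for every pair of points near `x`, as comparing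
  -- two orbits requires.
  obtain ⟨V, hV, hVA⟩ := hg.approximates_deriv_on_nhds (c := ⟨ε, hε0.le⟩) (Or.inr hε0)
  obtain ⟨ρ, hρ, hρV⟩ := Metric.mem_nhds_iff.1 hV
  refine ⟨Metric.ball x ρ, Metric.ball_mem_nhds x hρ, ?_⟩
  refine measure_eq_zero_of_sub_nonpos μ hQc (e := e) ?_ ?_
  · intro t ht
    have : Q (t • e) = (m - κ) * (t ^ 2 * ‖e‖ ^ 2) := by
      simp only [hQ, hBu, map_smul, hAe, inner_sub_left, inner_smul_left, inner_smul_right,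
        real_inner_self_eq_norm_sq, norm_smul, mul_pow, Real.norm_eq_abs, sq_abs, conj_trivial]
      ring
    rw [this]
    have := norm_pos_iff.2 he
    have := sub_pos.2 hκm
    positivity
  · intro z hz y hy
    by_contra! hpos
    have hgrow : ∀ t, (κ ^ 2) ^ t * Q (y - z) ≤ Q (g^[t] y - g^[t] z) := by
      intro t
      induction t with
      | zero => simp
      | succ t ih =>
        rw [Function.iterate_succ_apply', Function.iterate_succ_apply']
        have h := hVA _ (hρV (hy t)) _ (hρV (hz t))
        have h2 := hε (g^[t] y - g^[t] z)
          (g (g^[t] y) - g (g^[t] z) - A (g^[t] y - g^[t] z)) h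
        rw [add_sub_cancel] at h2
        refine le_trans ?_ h2
        rw [pow_succ', mul_assoc]
        gcongr
    have hbd : ∀ t, Q (g^[t] y - g^[t] z) ≤ ‖B‖ * (2 * ρ) * (2 * ρ) := by
      intro t
      have h1 : ‖g^[t] y - g^[t] z‖ ≤ 2 * ρ := by
        have a := Metric.mem_ball.1 (hy t)
        have b := Metric.mem_ball.1 (hz t)
        rw [← dist_eq_norm]
        linarith [dist_triangle_right (g^[t] y) (g^[t] z) x]
      refine (real_inner_le_norm _ _).trans ?_
      have h2 : ‖B (g^[t] y - g^[t] z)‖ ≤ ‖B‖ * (2 * ρ) := (B.le_opNorm _).trans (by gcongr)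
      gcongr
    obtain ⟨t, ht⟩ := pow_unbounded_of_one_lt (‖B‖ * (2 * ρ) * (2 * ρ) / Q (y - z))
      (show 1 < κ ^ 2 by nlinarith)
    rw [div_lt_iff₀ hpos] at ht
    linarith [hgrow t, hbd t]

/-- The preimage of a null set under a `C^1` map with injective derivatives is null. -/
theorem measure_inter_preimage_eq_zero {h : E → E} {Ω : Set E}
    (hh : ∀ z ∈ Ω, ContDiffAt ℝ 1 h z) (hinj : ∀ z ∈ Ω, ∀ u, fderiv ℝ h z u = 0 → u = 0)
    {B : Set E} (hB : μ B = 0) : μ (Ω ∩ h ⁻¹' B) = 0 := by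
  refine measure_null_of_locally_null _ fun z hz => ?_
  have hz' := hh z hz.1
  let e : E ≃L[ℝ] E := (LinearEquiv.ofInjectiveEndo (fderiv ℝ h z : E →ₗ[ℝ] E)
    (LinearMap.ker_eq_bot.1 (LinearMap.ker_eq_bot'.2 (hinj z hz.1)))).toContinuousLinearEquiv
  have he : HasFDerivAt h (e : E →L[ℝ] E) z := by
    refine (hz'.differentiableAt one_ne_zero).hasFDerivAt.congr_fderiv ?_
    ext u
    rfl
  let Φ := hz'.toOpenPartialHomeomorph h he one_ne_zero
  have hΦ : ∀ y, Φ y = h y := fun y => by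
    rw [hz'.toOpenPartialHomeomorph_coe he one_ne_zero]
  have hzs : z ∈ Φ.source := hz'.mem_toOpenPartialHomeomorph_source he one_ne_zero
  have hsymm : ContDiffAt ℝ 1 Φ.symm (h z) := hz'.to_localInverse he one_ne_zero
  have hev : ∀ᶠ y in 𝓝 (h z), DifferentiableAt ℝ Φ.symm y :=
    (hsymm.eventually (by simp)).mono fun y hy => hy.differentiableAt one_ne_zero
  have hev' : ∀ᶠ y in 𝓝 z, y ∈ Φ.source ∧ DifferentiableAt ℝ Φ.symm (h y) :=
    (show ∀ᶠ y in 𝓝 z, y ∈ Φ.source from Φ.open_source.mem_nhds hzs).and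
      (hz'.continuousAt.eventually hev)
  -- Locally the preimage lies in the image of `B` under the differentiable local inverse.
  refine ⟨{y | y ∈ Φ.source ∧ DifferentiableAt ℝ Φ.symm (h y)} ∩ h ⁻¹' B, ?_, ?_⟩
  · refine mem_nhdsWithin_iff_exists_mem_nhds_inter.2 ⟨_, hev', ?_⟩
    exact fun y hy => ⟨hy.1, hy.2.2⟩
  · have := addHaar_image_eq_zero_of_differentiableOn_of_addHaar_eq_zero μ
      (f := Φ.symm) (s := B ∩ {y | DifferentiableAt ℝ Φ.symm y})
      (fun y hy => hy.2.differentiableWithinAt) (measure_mono_null inter_subset_left hB)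
    refine measure_mono_null ?_ this
    rintro y ⟨⟨hy, hyd⟩, hyB⟩
    exact ⟨h y, ⟨hyB, hyd⟩, by rw [← hΦ]; exact Φ.left_inv hy⟩

end Analysis

/-! ### Radial projection and componentwise scaling -/

namespace ProductSphere

variable {N : ℕ} {d : Fin N → ℕ}

/-- The open set of the vectors of the ambient space all of whose components are nonzero. -/
def punctured (d : Fin N → ℕ) : Set (Ambient d) := {z | ∀ i, z i ≠ 0}

theorem isOpen_punctured : IsOpen (punctured d) := by
  have : punctured d = ⋂ i, {z : Ambient d | z i ≠ 0} := by ext; simp [punctured]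
  rw [this]
  exact isOpen_iInter_of_finite fun i =>
    isOpen_ne_fun (PiLp.continuous_apply 2 _ i) continuous_const

/-- Componentwise normalization, with an arbitrary value at a zero component. -/
def proj (z : Ambient d) : ProductSphere d := fun i =>
  if h : z i = 0 then ⟨EuclideanSpace.single 0 1, by simp⟩
  else ⟨‖z i‖⁻¹ • z i, by
    rw [mem_sphere_zero_iff_norm, norm_smul, norm_inv, norm_norm,
      inv_mul_cancel₀ (norm_ne_zero_iff.2 h)]⟩

theorem coe_proj {z : Ambient d} {i : Fin N} (h : z i ≠ 0) :
    (proj z i : EuclideanSpace ℝ (Fin (d i + 1))) = ‖z i‖⁻¹ • z i := by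
  simp [proj, h]

theorem incl_apply (x : ProductSphere d) (i : Fin N) :
    incl x i = (x i : EuclideanSpace ℝ (Fin (d i + 1))) := rfl

theorem norm_coe (x : ProductSphere d) (i : Fin N) :
    ‖(x i : EuclideanSpace ℝ (Fin (d i + 1)))‖ = 1 := norm_eq_of_mem_sphere (x i)

theorem coe_ne_zero (x : ProductSphere d) (i : Fin N) :
    (x i : EuclideanSpace ℝ (Fin (d i + 1))) ≠ 0 :=
  norm_ne_zero_iff.1 (by rw [norm_coe]; exact one_ne_zero)

theorem incl_mem_punctured (x : ProductSphere d) : incl x ∈ punctured d := coe_ne_zero x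

theorem proj_eq_of_smul {z : Ambient d} {x : ProductSphere d} {c : Fin N → ℝ}
    (hc : ∀ i, 0 < c i) (hz : ∀ i, z i = c i • (x i : EuclideanSpace ℝ (Fin (d i + 1)))) :
    proj z = x := by
  funext i
  apply Subtype.ext
  have h0 : z i ≠ 0 := by rw [hz]; exact smul_ne_zero (hc i).ne' (coe_ne_zero x i)
  rw [coe_proj h0, hz, norm_smul, norm_coe, Real.norm_of_nonneg (hc i).le, mul_one, smul_smul,
    inv_mul_cancel₀ (hc i).ne', one_smul]

theorem proj_incl (x : ProductSphere d) : proj (incl x) = x :=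
  proj_eq_of_smul (c := fun _ => 1) (fun _ => one_pos) fun i => by rw [one_smul, incl_apply]

theorem eq_norm_smul_proj {z : Ambient d} (hz : z ∈ punctured d) (i : Fin N) :
    z i = ‖z i‖ • (proj z i : EuclideanSpace ℝ (Fin (d i + 1))) := by
  rw [coe_proj (hz i), smul_smul, mul_inv_cancel₀ (norm_ne_zero_iff.2 (hz i)), one_smul]

theorem proj_congr {z w : Ambient d} {c : Fin N → ℝ} (hw : w ∈ punctured d)
    (hc : ∀ i, 0 < c i) (hz : ∀ i, z i = c i • w i) : proj z = proj w :=
  proj_eq_of_smul (c := fun i => c i * ‖w i‖)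
    (fun i => mul_pos (hc i) (norm_pos_iff.2 (hw i)))
    fun i => by rw [hz, mul_smul, ← eq_norm_smul_proj hw]

theorem proj_incl_add (x : ProductSphere d) (v : tangent x) :
    proj (incl x + (v : Ambient d)) = retr x v := by
  refine proj_eq_of_smul
    (c := fun i => ‖(x i : EuclideanSpace ℝ (Fin (d i + 1))) + (v : Ambient d) i‖)
    (fun i => one_pos.trans_le (one_le_norm_add x v i)) fun i => ?_
  have h := one_le_norm_add x v i
  simp only [retr]
  rw [smul_smul, mul_inv_cancel₀ (by positivity), one_smul]
  rfl

theorem contMDiffAt_proj {z : Ambient d} (hz : z ∈ punctured d) :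
    ContMDiffAt 𝓘(ℝ, Ambient d) (model d) ∞ proj z := by
  have hcomp : ∀ i, ContMDiffAt 𝓘(ℝ, Ambient d) (𝓡 (d i)) ∞ (fun w : Ambient d => proj w i) z := by
    intro i
    -- Smoothness into the sphere is obtained for a globally smooth map, hence the passage to the
    -- open submanifold.
    let U : TopologicalSpace.Opens (Ambient d) := ⟨punctured d, isOpen_punctured⟩
    rw [← contMDiffAt_subtype_iff (U := U) (x := ⟨z, hz⟩)]
    have h1 : ContMDiff 𝓘(ℝ, Ambient d) 𝓘(ℝ, EuclideanSpace ℝ (Fin (d i + 1))) ∞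
        (fun w : U => (proj (w : Ambient d) i : EuclideanSpace ℝ (Fin (d i + 1)))) := by
      intro w
      refine (contMDiffAt_subtype_iff (U := U) (x := w)
        (f := fun w => (proj (w : Ambient d) i : EuclideanSpace ℝ (Fin (d i + 1))))).2 ?_
      rw [contMDiffAt_iff_contDiffAt]
      have hwi : (w : Ambient d) i ≠ 0 := w.2 i
      have h2 : ContDiffAt ℝ ∞ (fun w : Ambient d => w i) (w : Ambient d) :=
        contDiffAt_piLp_apply 2
      refine (((h2.norm ℝ hwi).inv (norm_ne_zero_iff.2 hwi)).smul h2).congr_of_eventuallyEq ?_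
      filter_upwards [isOpen_punctured.mem_nhds w.2] with y hy
      exact coe_proj (hy i)
    have := Fact.mk (@finrank_euclideanSpace_fin ℝ _ (d i + 1))
    exact (ContMDiff.codRestrict_sphere (n := d i) h1 fun w => (proj (w : Ambient d) i).2) ⟨z, hz⟩
  rw [contMDiffAt_iff_target]
  refine ⟨continuousAt_pi.2 fun i => (hcomp i).continuousAt, ?_⟩
  refine contMDiffAt_pi_space.2 fun i => ?_
  exact (contMDiffAt_iff_target.1 (hcomp i)).2

theorem contDiffAt_comp_proj {f : ProductSphere d → ℝ} (hf : ContMDiff (model d) 𝓘(ℝ, ℝ) 2 f)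
    {z : Ambient d} (hz : z ∈ punctured d) : ContDiffAt ℝ 2 (fun w => f (proj w)) z := by
  rw [← contMDiffAt_iff_contDiffAt]
  exact ContMDiffAt.comp z (hf (proj z)) ((contMDiffAt_proj hz).of_le ENat.LEInfty.out)

/-- Componentwise scaling. -/
def blockScale (c : Fin N → ℝ) : Ambient d →L[ℝ] Ambient d :=
  LinearMap.toContinuousLinearMap
    { toFun := fun z => WithLp.toLp 2 fun i => c i • z i
      map_add' := fun z w => by ext i : 1; simp
      map_smul' := fun a z => by ext i : 1; exact smul_comm (c i) a (z i) }

@[simp]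
theorem blockScale_apply (c : Fin N → ℝ) (z : Ambient d) (i : Fin N) :
    blockScale c z i = c i • z i := rfl

theorem blockScale_mem_punctured {c : Fin N → ℝ} (hc : ∀ i, 0 < c i) {z : Ambient d}
    (hz : z ∈ punctured d) : blockScale c z ∈ punctured d := fun i =>
  smul_ne_zero (hc i).ne' (hz i)

theorem proj_blockScale {c : Fin N → ℝ} (hc : ∀ i, 0 < c i) {z : Ambient d}
    (hz : z ∈ punctured d) : proj (blockScale c z) = proj z :=
  proj_congr hz hc fun _ => rfl

theorem incl_proj {z : Ambient d} (hz : z ∈ punctured d) :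
    incl (proj z) = blockScale (fun i => ‖z i‖⁻¹) z := by
  ext i : 1
  rw [incl_apply, coe_proj (hz i)]
  rfl

theorem blockScale_incl_proj {z : Ambient d} (hz : z ∈ punctured d) :
    blockScale (fun i => ‖z i‖) (incl (proj z)) = z := by
  ext i : 1
  rw [blockScale_apply, incl_apply, ← eq_norm_smul_proj hz]

theorem inner_tangent (x : ProductSphere d) (v : tangent x) (i : Fin N) :
    inner ℝ (x i : EuclideanSpace ℝ (Fin (d i + 1))) ((v : Ambient d) i) = 0 := v.2 i

/-- The tangential part of an ambient vector. -/
def tangentPart (x : ProductSphere d) (u : Ambient d) : tangent x :=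
  ⟨u - blockScale (fun i => inner ℝ (x i : EuclideanSpace ℝ (Fin (d i + 1))) (u i)) (incl x), by
    intro i
    simp only [PiLp.sub_apply, blockScale_apply, incl_apply, inner_sub_right, inner_smul_right,
      real_inner_self_eq_norm_sq, norm_coe]
    ring⟩

theorem tangentPart_add (x : ProductSphere d) (u : Ambient d) :
    (tangentPart x u : Ambient d) +
      blockScale (fun i => inner ℝ (x i : EuclideanSpace ℝ (Fin (d i + 1))) (u i)) (incl x) = u :=
  sub_add_cancel _ _

theorem inner_blockScale_incl (x : ProductSphere d) (v : tangent x) (c : Fin N → ℝ) :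
    inner ℝ (v : Ambient d) (blockScale c (incl x)) = 0 := by
  rw [PiLp.inner_apply]
  refine Finset.sum_eq_zero fun i _ => ?_
  rw [blockScale_apply, inner_smul_right, real_inner_comm, incl_apply, inner_tangent, mul_zero]

theorem inner_tangentPart (x : ProductSphere d) (v : tangent x) (u : Ambient d) :
    inner ℝ (v : Ambient d) (tangentPart x u : Ambient d) = inner ℝ (v : Ambient d) u := by
  conv_rhs => rw [← tangentPart_add x u]
  rw [inner_add_right, inner_blockScale_incl, add_zero]

/-- A map that is constant on the fibres of `proj` has zero derivative along them. -/
theorem fderiv_blockScale_self {F : Type*} [NormedAddCommGroup F] [NormedSpace ℝ F]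
    {k : ProductSphere d → F} {z : Ambient d} (hz : z ∈ punctured d)
    (hk : DifferentiableAt ℝ (fun w => k (proj w)) z) (c : Fin N → ℝ) :
    fderiv ℝ (fun w => k (proj w)) z (blockScale c z) = 0 := by
  have h1 : HasDerivAt (fun t : ℝ => z + t • blockScale c z) (blockScale c z) 0 := by
    simpa using ((hasDerivAt_id (0 : ℝ)).smul_const (blockScale c z)).const_add z
  have hk' : HasFDerivAt (fun w => k (proj w)) (fderiv ℝ (fun w => k (proj w)) z)
      (z + (0 : ℝ) • blockScale c z) := by simpa using hk.hasFDerivAt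
  have h2 := hk'.comp_hasDerivAt (0 : ℝ) h1
  -- For small `t` the segment from `z` stays in its fibre.
  have hev : ∀ᶠ t : ℝ in 𝓝 0, ∀ i, 0 < 1 + t * c i := by
    refine Filter.eventually_all.2 fun i => ?_
    have : ContinuousAt (fun t : ℝ => 1 + t * c i) 0 := by fun_prop
    exact this.eventually (lt_mem_nhds (by simp))
  refine h2.unique ((hasDerivAt_const (0 : ℝ) (k (proj z))).congr_of_eventuallyEq ?_)
  filter_upwards [hev] with t ht
  have : z + t • blockScale c z = blockScale (fun i => 1 + t * c i) z := by
    ext i : 1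
    simp [add_smul, mul_smul]
  simp only [Function.comp, this, proj_blockScale ht hz]

/-! ### Gradient and Hessian through homogeneous extensions -/

variable {f : ProductSphere d → ℝ}

/-- `f ∘ R_x` is the restriction of `f ∘ proj` to the affine tangent space. -/
theorem inner_grad (hf : ContMDiff (model d) 𝓘(ℝ, ℝ) 2 f) (x : ProductSphere d) (v : tangent x) :
    inner ℝ (grad f x : Ambient d) (v : Ambient d) =
      fderiv ℝ (fun w => f (proj w)) (incl x) v := by
  have hd : DifferentiableAt ℝ (fun w => f (proj w)) (incl x + ((0 : tangent x) : Ambient d)) := by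
    simpa using (contDiffAt_comp_proj hf (incl_mem_punctured x)).differentiableAt two_ne_zero
  have h := hd.hasFDerivAt.comp (0 : tangent x)
    ((tangent x).subtypeL.hasFDerivAt.const_add (incl x))
  have h2 : HasFDerivAt (fun v : tangent x => f (retr x v))
      ((fderiv ℝ (fun w => f (proj w)) (incl x)).comp (tangent x).subtypeL) 0 := by
    simp only [ZeroMemClass.coe_zero, add_zero] at h
    refine h.congr_of_eventuallyEq (Filter.Eventually.of_forall fun v => ?_)
    simp [proj_incl_add]
  have h3 : inner ℝ (grad f x) v = fderiv ℝ (fun v : tangent x => f (retr x v)) 0 v := by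
    simp [grad, gradient]
  rw [h2.fderiv] at h3
  exact h3

/-- The `0`-homogeneous extension of the Riemannian gradient. -/
def gradExt (f : ProductSphere d → ℝ) (z : Ambient d) : Ambient d := (grad f (proj z) : Ambient d)

theorem gradExt_congr {z w : Ambient d} (h : proj z = proj w) : gradExt f z = gradExt f w := by
  rw [gradExt, gradExt, h]

theorem gradExt_incl (x : ProductSphere d) : gradExt f (incl x) = grad f x := by
  rw [gradExt, proj_incl]

theorem fderiv_comp_proj_incl (hf : ContMDiff (model d) 𝓘(ℝ, ℝ) 2 f) (x : ProductSphere d)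
    (u : Ambient d) :
    fderiv ℝ (fun w => f (proj w)) (incl x) u = inner ℝ (grad f x : Ambient d) u := by
  have hd := (contDiffAt_comp_proj hf (incl_mem_punctured x)).differentiableAt two_ne_zero
  conv_lhs => rw [← tangentPart_add x u]
  rw [map_add, fderiv_blockScale_self (incl_mem_punctured x) hd, add_zero, ← inner_grad hf,
    inner_tangentPart]

/-- Invariance of `f ∘ proj` under scaling moves the derivative from the normalized point to `z`, at
the price of the inverse norms. -/
theorem fderiv_comp_proj (hf : ContMDiff (model d) 𝓘(ℝ, ℝ) 2 f) {z : Ambient d}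
    (hz : z ∈ punctured d) (u : Ambient d) :
    fderiv ℝ (fun w => f (proj w)) z u =
      inner ℝ (blockScale (fun i => ‖z i‖⁻¹) (gradExt f z)) u := by
  have hd : DifferentiableAt ℝ (fun w => f (proj w)) (blockScale (fun i => ‖z i‖⁻¹) z) := by
    rw [← incl_proj hz]
    exact (contDiffAt_comp_proj hf (incl_mem_punctured _)).differentiableAt two_ne_zero
  have hc : ∀ i, 0 < ‖z i‖⁻¹ := fun i => inv_pos.2 (norm_pos_iff.2 (hz i))
  have h := hd.hasFDerivAt.comp z (blockScale (fun i => ‖z i‖⁻¹)).hasFDerivAt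
  have h2 := h.congr_of_eventuallyEq (f₁ := fun w => f (proj w)) (by
    filter_upwards [isOpen_punctured.mem_nhds hz] with w hw
    simp only [Function.comp, proj_blockScale hc hw])
  rw [h2.fderiv, ContinuousLinearMap.comp_apply, ← incl_proj hz, fderiv_comp_proj_incl hf]
  simp [PiLp.inner_apply, gradExt, inner_smul_left, inner_smul_right]

theorem gradient_comp_proj (hf : ContMDiff (model d) 𝓘(ℝ, ℝ) 2 f) {z : Ambient d}
    (hz : z ∈ punctured d) :
    gradient (fun w => f (proj w)) z = blockScale (fun i => ‖z i‖⁻¹) (gradExt f z) := by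
  refine ext_inner_right ℝ fun u => ?_
  rw [← fderiv_comp_proj hf hz]
  simp [gradient]

theorem contDiffAt_gradient_comp_proj (hf : ContMDiff (model d) 𝓘(ℝ, ℝ) 2 f) {z : Ambient d}
    (hz : z ∈ punctured d) : ContDiffAt ℝ 1 (gradient fun w => f (proj w)) z := by
  have h1 : ContDiffAt ℝ 1 (fderiv ℝ fun w => f (proj w)) z :=
    (contDiffAt_comp_proj hf hz).fderiv_right (by norm_num [one_add_one_eq_two])
  exact (InnerProductSpace.toDual ℝ (Ambient d)).symm.contDiff.contDiffAt.comp z h1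

theorem contDiffAt_norm_apply {n : ℕ∞} {z : Ambient d} (hz : z ∈ punctured d) (i : Fin N) :
    ContDiffAt ℝ n (fun w : Ambient d => ‖w i‖) z :=
  (contDiffAt_piLp_apply 2).norm ℝ (hz i)

/-- Each component is `‖z i‖` times that of the Euclidean gradient of the `C^2` function `f ∘ proj`.
-/
theorem contDiffAt_gradExt (hf : ContMDiff (model d) 𝓘(ℝ, ℝ) 2 f) {z : Ambient d}
    (hz : z ∈ punctured d) : ContDiffAt ℝ 1 (gradExt f) z := by
  refine (contDiffAt_piLp 2).2 fun i => ?_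
  have h2 : ContDiffAt ℝ 1 (fun w => gradient (fun w => f (proj w)) w i) z :=
    (contDiffAt_piLp 2).1 (contDiffAt_gradient_comp_proj hf hz) i
  refine ((contDiffAt_norm_apply (n := 1) hz i).smul h2).congr_of_eventuallyEq ?_
  filter_upwards [isOpen_punctured.mem_nhds hz] with w hw
  change _ = ‖w i‖ • gradient (fun w => f (proj w)) w i
  rw [gradient_comp_proj hf hw, blockScale_apply, smul_smul,
    mul_inv_cancel₀ (norm_ne_zero_iff.2 (hw i)), one_smul]

theorem differentiableAt_gradExt (hf : ContMDiff (model d) 𝓘(ℝ, ℝ) 2 f) {z : Ambient d}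
    (hz : z ∈ punctured d) : DifferentiableAt ℝ (gradExt f) z :=
  (contDiffAt_gradExt hf hz).differentiableAt one_ne_zero

theorem inner_gradExt {z : Ambient d} (hz : z ∈ punctured d) (i : Fin N) :
    inner ℝ (z i) (gradExt f z i) = 0 := by
  rw [eq_norm_smul_proj hz, inner_smul_left, gradExt, inner_tangent, mul_zero]

/-- Differentiating `⟪z i, gradExt f z i⟫ = 0`. -/
theorem inner_fderiv_gradExt (hf : ContMDiff (model d) 𝓘(ℝ, ℝ) 2 f) (x : ProductSphere d)
    (u : Ambient d) (i : Fin N) :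
    inner ℝ (x i : EuclideanSpace ℝ (Fin (d i + 1))) (fderiv ℝ (gradExt f) (incl x) u i) =
      -inner ℝ (u i) ((grad f x : Ambient d) i) := by
  have hx := incl_mem_punctured x
  let p := PiLp.proj (𝕜 := ℝ) 2 (fun i : Fin N => EuclideanSpace ℝ (Fin (d i + 1))) i
  have h1 : HasFDerivAt (fun w : Ambient d => w i) p (incl x) := p.hasFDerivAt
  have h2 : HasFDerivAt (fun w : Ambient d => gradExt f w i)
      (p.comp (fderiv ℝ (gradExt f) (incl x))) (incl x) :=
    p.hasFDerivAt.comp (incl x) (differentiableAt_gradExt hf hx).hasFDerivAt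
  have h3 := h1.inner ℝ h2
  have h4 : HasFDerivAt (fun w : Ambient d => inner ℝ (w i) (gradExt f w i))
      (0 : Ambient d →L[ℝ] ℝ) (incl x) := by
    refine (hasFDerivAt_const (0 : ℝ) (incl x)).congr_of_eventuallyEq ?_
    filter_upwards [isOpen_punctured.mem_nhds hx] with w hw
    exact inner_gradExt hw i
  have h5 := DFunLike.congr_fun (h3.unique h4) u
  simp [p, fderivInnerCLM_apply, gradExt_incl, incl_apply] at h5
  linarith

/-- The derivative of the extended gradient along the components of the base point is zero. -/
theorem fderiv_gradExt_tangentPart (hf : ContMDiff (model d) 𝓘(ℝ, ℝ) 2 f) (x : ProductSphere d)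
    (u : Ambient d) : fderiv ℝ (gradExt f) (incl x) (tangentPart x u) =
      fderiv ℝ (gradExt f) (incl x) u := by
  have hx := incl_mem_punctured x
  conv_rhs => rw [← tangentPart_add x u]
  rw [map_add]
  have := fderiv_blockScale_self (k := fun y => (grad f y : Ambient d)) hx
    (differentiableAt_gradExt hf hx)
    (fun i => inner ℝ (x i : EuclideanSpace ℝ (Fin (d i + 1))) (u i))
  exact (add_eq_left.2 this).symm

theorem hess_eq (hf : ContMDiff (model d) 𝓘(ℝ, ℝ) 2 f) (x : ProductSphere d) (v : tangent x) :
    hess f x v =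
      (tangent x).orthogonalProjectionOnto (fderiv ℝ (gradExt f) (incl x) (v : Ambient d)) := by
  have hd : DifferentiableAt ℝ (gradExt f) (incl x + ((0 : tangent x) : Ambient d)) := by
    simpa using differentiableAt_gradExt hf (incl_mem_punctured x)
  have h := hd.hasFDerivAt.comp (0 : tangent x)
    ((tangent x).subtypeL.hasFDerivAt.const_add (incl x))
  simp only [ZeroMemClass.coe_zero, add_zero] at h
  have h2 : HasFDerivAt (fun v : tangent x => (grad f (retr x v) : Ambient d))
      ((fderiv ℝ (gradExt f) (incl x)).comp (tangent x).subtypeL) 0 := by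
    refine h.congr_of_eventuallyEq (Filter.Eventually.of_forall fun v => ?_)
    change _ = gradExt f (incl x + (v : Ambient d))
    rw [gradExt, proj_incl_add]
  rw [hess, h2.fderiv]
  rfl

theorem inner_hess (hf : ContMDiff (model d) 𝓘(ℝ, ℝ) 2 f) (x : ProductSphere d) (v w : tangent x) :
    inner ℝ (hess f x v) w =
      inner ℝ (fderiv ℝ (gradExt f) (incl x) (v : Ambient d)) (w : Ambient d) := by
  rw [hess_eq hf, Submodule.inner_orthogonalProjectionOnto_eq_of_mem_right]

theorem inner_fderiv_gradExt_self_le (hf : ContMDiff (model d) 𝓘(ℝ, ℝ) 2 f) {L : ℝ}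
    (hfL : GradLipschitz f L) (x : ProductSphere d) (v : tangent x) :
    inner ℝ (fderiv ℝ (gradExt f) (incl x) (v : Ambient d)) (v : Ambient d) ≤
      L * ‖(v : Ambient d)‖ ^ 2 := by
  rw [← inner_hess hf]
  refine (real_inner_le_norm _ _).trans ?_
  calc ‖hess f x v‖ * ‖v‖ ≤ L * ‖v‖ * ‖v‖ := by gcongr; exact hfL x v
    _ = L * ‖(v : Ambient d)‖ ^ 2 := by rw [Submodule.norm_coe]; ring

/-! ### Null preimages: injectivity of the derivative of the step -/

/-- The extension to the ambient space of `x ↦ x - α grad f(x)`, homogeneous in each component. -/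
def step (f : ProductSphere d → ℝ) (α : ℝ) (z : Ambient d) : Ambient d :=
  z - α • blockScale (fun i => ‖z i‖) (gradExt f z)

theorem step_blockScale (α : ℝ) {c : Fin N → ℝ} (hc : ∀ i, 0 < c i) {z : Ambient d}
    (hz : z ∈ punctured d) : step f α (blockScale c z) = blockScale c (step f α z) := by
  ext i : 1
  rw [step, gradExt_congr (proj_blockScale hc hz)]
  simp [step, norm_smul, abs_of_pos (hc i), smul_smul]

theorem step_incl (α : ℝ) (x : ProductSphere d) :
    step f α (incl x) = incl x + ((-(α • grad f x) : tangent x) : Ambient d) := by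
  ext i : 1
  simp [step, gradExt_incl, incl_apply, sub_eq_add_neg]

theorem step_mem_punctured (α : ℝ) {z : Ambient d} (hz : z ∈ punctured d) :
    step f α z ∈ punctured d := by
  have h : step f α (incl (proj z)) ∈ punctured d := by
    intro i
    rw [step_incl, ← norm_ne_zero_iff]
    exact (one_pos.trans_le (one_le_norm_add (proj z) (-(α • grad f (proj z))) i)).ne'
  have hc : ∀ i, 0 < ‖z i‖ := fun i => norm_pos_iff.2 (hz i)
  rw [← blockScale_incl_proj hz, step_blockScale α hc (incl_mem_punctured _)]
  exact blockScale_mem_punctured hc h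

theorem proj_step (α : ℝ) {z : Ambient d} (hz : z ∈ punctured d) :
    proj (step f α z) = rgd f α (proj z) := by
  have h : step f α (incl (proj z)) ∈ punctured d := step_mem_punctured α (incl_mem_punctured _)
  have hc : ∀ i, 0 < ‖z i‖ := fun i => norm_pos_iff.2 (hz i)
  conv_lhs => rw [← blockScale_incl_proj hz]
  rw [step_blockScale α hc (incl_mem_punctured _), proj_blockScale hc h, step_incl,
    proj_incl_add]
  rfl

theorem contDiffAt_step (hf : ContMDiff (model d) 𝓘(ℝ, ℝ) 2 f) (α : ℝ) {z : Ambient d}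
    (hz : z ∈ punctured d) : ContDiffAt ℝ 1 (step f α) z := by
  refine contDiffAt_id.sub (ContDiffAt.const_smul α ?_)
  exact (contDiffAt_piLp 2).2 fun i => (contDiffAt_norm_apply (n := 1) hz i).smul
    ((contDiffAt_piLp 2).1 (contDiffAt_gradExt hf hz) i)

theorem fderiv_step_incl_apply (hf : ContMDiff (model d) 𝓘(ℝ, ℝ) 2 f) (α : ℝ)
    (x : ProductSphere d) (u : Ambient d) (i : Fin N) :
    fderiv ℝ (step f α) (incl x) u i = u i - α • (fderiv ℝ (gradExt f) (incl x) u i +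
      inner ℝ (x i : EuclideanSpace ℝ (Fin (d i + 1))) (u i) • (grad f x : Ambient d) i) := by
  have hx := incl_mem_punctured x
  let p := PiLp.proj (𝕜 := ℝ) 2 (fun i : Fin N => EuclideanSpace ℝ (Fin (d i + 1))) i
  have h1 : HasFDerivAt (fun w : Ambient d => w i) p (incl x) := p.hasFDerivAt
  have h2 : HasFDerivAt (fun w : Ambient d => gradExt f w i)
      (p.comp (fderiv ℝ (gradExt f) (incl x))) (incl x) :=
    p.hasFDerivAt.comp (incl x) (differentiableAt_gradExt hf hx).hasFDerivAt
  have h0 : HasFDerivAt (fun w : Ambient d => ‖w i‖)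
      (fderiv ℝ (fun w : Ambient d => ‖w i‖) (incl x)) (incl x) :=
    ((contDiffAt_norm_apply (n := 1) hx i).differentiableAt one_ne_zero).hasFDerivAt
  have hn : fderiv ℝ (fun w : Ambient d => ‖w i‖) (incl x) u =
      inner ℝ (x i : EuclideanSpace ℝ (Fin (d i + 1))) (u i) := by
    have e1 := h0.pow 2
    have e2 := h1.norm_sq
    have e3 := DFunLike.congr_fun (e1.unique e2) u
    simp [p, incl_apply] at e3
    linarith
  have h3 := h1.sub ((h0.smul h2).const_smul α)
  have h4 : HasFDerivAt (fun w => step f α w i) (p.comp (fderiv ℝ (step f α) (incl x))) (incl x) :=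
    p.hasFDerivAt.comp (incl x)
      ((contDiffAt_step hf α hx).differentiableAt one_ne_zero).hasFDerivAt
  have h5 := DFunLike.congr_fun (h4.unique h3) u
  simpa [p, incl_apply, norm_coe, gradExt_incl, hn] using h5

/-- Pair the kernel equation with each `x i`, giving the normal parts `-α ⟪G i, u i⟫`, then with the
tangential part `τ`. The Hessian bound and the sign of the normal contribution leave `‖τ‖² ≤ α L
‖τ‖²`. -/
theorem fderiv_step_incl_injective (hf : ContMDiff (model d) 𝓘(ℝ, ℝ) 2 f) {L : ℝ}
    (hfL : GradLipschitz f L) {α : ℝ} (hα : 0 < α) (hαL : α * L < 1) (x : ProductSphere d)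
    {u : Ambient d} (hu : fderiv ℝ (step f α) (incl x) u = 0) : u = 0 := by
  set τ := tangentPart x u with hτ
  set Γ := fderiv ℝ (gradExt f) (incl x) with hΓ
  set G : Ambient d := (grad f x : Ambient d) with hG
  have hi : ∀ i, u i = α • (Γ u i +
      inner ℝ (x i : EuclideanSpace ℝ (Fin (d i + 1))) (u i) • G i) := fun i => by
    have := fderiv_step_incl_apply hf α x u i
    rw [hu] at this
    exact sub_eq_zero.1 this.symm
  have hGτ : ∀ i, inner ℝ (G i) (u i) = inner ℝ (G i) ((τ : Ambient d) i) := by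
    intro i
    conv_lhs => rw [← tangentPart_add x u]
    rw [PiLp.add_apply, inner_add_right, blockScale_apply, inner_smul_right,
      incl_apply, real_inner_comm (x i : EuclideanSpace ℝ (Fin (d i + 1))) (G i), hG, inner_tangent,
      mul_zero, add_zero]
  have ha : ∀ i, inner ℝ (x i : EuclideanSpace ℝ (Fin (d i + 1))) (u i) =
      -(α * inner ℝ (G i) (u i)) := by
    intro i
    conv_lhs => rw [hi i]
    rw [inner_smul_right, inner_add_right, inner_smul_right, inner_fderiv_gradExt hf,
      inner_tangent, mul_zero, add_zero, real_inner_comm]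
    ring
  have h1 : ‖(τ : Ambient d)‖ ^ 2 = α * inner ℝ (Γ u) (τ : Ambient d) +
      α * ∑ i, inner ℝ (x i : EuclideanSpace ℝ (Fin (d i + 1))) (u i) *
        inner ℝ (G i) ((τ : Ambient d) i) := by
    have hu' : u = α • (Γ u + blockScale
        (fun i => inner ℝ (x i : EuclideanSpace ℝ (Fin (d i + 1))) (u i)) G) := by
      ext i : 1
      exact hi i
    rw [← real_inner_self_eq_norm_sq, inner_tangentPart, real_inner_comm]
    conv_lhs => rw [hu']
    rw [inner_smul_left, inner_add_left, conj_trivial, mul_add]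
    congr 2
    simp [PiLp.inner_apply, inner_smul_left]
  have h2 : inner ℝ (Γ u) (τ : Ambient d) ≤ L * ‖(τ : Ambient d)‖ ^ 2 := by
    rw [hΓ, ← fderiv_gradExt_tangentPart hf]
    exact inner_fderiv_gradExt_self_le hf hfL x τ
  -- The sum equals `-α ∑ ⟪G i, τ i⟫²`.
  have h3 : ∑ i, inner ℝ (x i : EuclideanSpace ℝ (Fin (d i + 1))) (u i) *
        inner ℝ (G i) ((τ : Ambient d) i) ≤ 0 := by
    refine Finset.sum_nonpos fun i _ => ?_
    rw [ha, hGτ]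
    nlinarith [sq_nonneg (inner ℝ (G i) ((τ : Ambient d) i))]
  have h4 : ‖(τ : Ambient d)‖ ^ 2 ≤ α * L * ‖(τ : Ambient d)‖ ^ 2 := by
    nlinarith
  have hτ0 : (τ : Ambient d) = 0 := by
    by_contra hne
    have := norm_pos_iff.2 hne
    have : 0 < ‖(τ : Ambient d)‖ ^ 2 := by positivity
    nlinarith
  have := tangentPart_add x u
  rw [← hτ, hτ0, zero_add] at this
  rw [← this]
  ext i : 1
  rw [blockScale_apply, ha, hGτ, hτ0]
  simp

/-- `step` commutes with scaling, so its derivative at `z` is conjugate to that at the normalized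
point. -/
theorem fderiv_step_injective (hf : ContMDiff (model d) 𝓘(ℝ, ℝ) 2 f) {L : ℝ}
    (hfL : GradLipschitz f L) {α : ℝ} (hα : 0 < α) (hαL : α * L < 1) {z : Ambient d}
    (hz : z ∈ punctured d) {u : Ambient d} (hu : fderiv ℝ (step f α) z u = 0) : u = 0 := by
  have hc : ∀ i, 0 < ‖z i‖ := fun i => norm_pos_iff.2 (hz i)
  have hx := incl_mem_punctured (proj z)
  set S : Ambient d →L[ℝ] Ambient d := blockScale (fun i => ‖z i‖) with hS
  have hSz : S (incl (proj z)) = z := blockScale_incl_proj hz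
  have h1 : HasFDerivAt (fun w => step f α (S w)) ((fderiv ℝ (step f α) z).comp S)
      (incl (proj z)) := by
    have h0 : HasFDerivAt (step f α) (fderiv ℝ (step f α) z) (S (incl (proj z))) := by
      rw [hSz]
      exact ((contDiffAt_step hf α hz).differentiableAt one_ne_zero).hasFDerivAt
    exact h0.comp (incl (proj z)) S.hasFDerivAt
  have h2 : HasFDerivAt (fun w => step f α (S w))
      (S.comp (fderiv ℝ (step f α) (incl (proj z)))) (incl (proj z)) := by
    refine (S.hasFDerivAt.comp (incl (proj z)) ((contDiffAt_step hf α
      hx).differentiableAt one_ne_zero).hasFDerivAt).congr_of_eventuallyEq ?_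
    filter_upwards [isOpen_punctured.mem_nhds hx] with w hw
    exact step_blockScale α hc hw
  have hSinv : ∀ w : Ambient d, S (blockScale (fun i => ‖z i‖⁻¹) w) = w := fun w => by
    ext i : 1
    simp only [hS, blockScale_apply, smul_smul]
    rw [mul_inv_cancel₀ (hc i).ne', one_smul]
  have hSinj : ∀ w, S w = 0 → w = 0 := fun w hw => by
    ext i : 1
    have : ‖z i‖ • w i = 0 := congrArg (fun v : Ambient d => v i) hw
    exact (smul_eq_zero.1 this).resolve_left (hc i).ne'
  have h3 := DFunLike.congr_fun (h1.unique h2) (blockScale (fun i => ‖z i‖⁻¹) u)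
  simp only [ContinuousLinearMap.comp_apply, hSinv, hu] at h3
  have h4 := fderiv_step_incl_injective hf hfL hα hαL _ (hSinj _ h3.symm)
  rw [← hSinv u, h4, map_zero]

theorem measure_preimage_rgd_eq_zero (hf : ContMDiff (model d) 𝓘(ℝ, ℝ) 2 f) {L : ℝ}
    (hfL : GradLipschitz f L) {α : ℝ} (hα : 0 < α) (hαL : α * L < 1)
    (μ : MeasureTheory.Measure (Ambient d)) [μ.IsAddHaarMeasure] {A : Set (ProductSphere d)}
    (hA : μ (punctured d ∩ proj ⁻¹' A) = 0) :
    μ (punctured d ∩ proj ⁻¹' (rgd f α ⁻¹' A)) = 0 := by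
  refine MeasureTheory.measure_mono_null ?_ (measure_inter_preimage_eq_zero μ
    (fun z hz => contDiffAt_step hf α hz)
    (fun z hz u hu => fderiv_step_injective hf hfL hα hαL hz hu) hA)
  rintro z ⟨hz, hzA⟩
  refine ⟨hz, step_mem_punctured α hz, ?_⟩
  rw [Set.mem_preimage, proj_step α hz]
  exact hzA

/-! ### The norm-preserving extension and its linearization at critical points -/

/-- The extension of the iteration map to the ambient space, preserving the norms of the
components. -/
def rgdExt (f : ProductSphere d → ℝ) (α : ℝ) (z : Ambient d) : Ambient d :=
  blockScale (fun i => ‖z i‖) (incl (rgd f α (proj z)))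

theorem rgdExt_blockScale_incl (α : ℝ) {c : Fin N → ℝ} (hc : ∀ i, 0 < c i) (x : ProductSphere d) :
    rgdExt f α (blockScale c (incl x)) = blockScale c (incl (rgd f α x)) := by
  rw [rgdExt, proj_blockScale hc (incl_mem_punctured x), proj_incl]
  ext i : 1
  simp [norm_smul, abs_of_pos (hc i), incl_apply]

theorem iterate_rgdExt (α : ℝ) {z : Ambient d} (hz : z ∈ punctured d) (t : ℕ) :
    (rgdExt f α)^[t] z = blockScale (fun i => ‖z i‖) (incl ((rgd f α)^[t] (proj z))) := by
  induction t with
  | zero => exact (blockScale_incl_proj hz).symm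
  | succ t ih =>
    rw [Function.iterate_succ_apply', ih,
      rgdExt_blockScale_incl α (fun i => norm_pos_iff.2 (hz i)), Function.iterate_succ_apply']

/-- By orthogonality, the normalizing factor is the inverse square root of a quantity at least `1`,
which is `C^1` in `z`. -/
theorem rgdExt_apply (α : ℝ) {z : Ambient d} (hz : z ∈ punctured d) (i : Fin N) :
    rgdExt f α z i = (√(1 + α ^ 2 * ‖gradExt f z i‖ ^ 2))⁻¹ • step f α z i := by
  have hs : step f α z = blockScale (fun i => ‖z i‖)
      (incl (proj z) + ((-(α • grad f (proj z)) : tangent (proj z)) : Ambient d)) := by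
    conv_lhs => rw [← blockScale_incl_proj hz]
    rw [step_blockScale α (fun i => norm_pos_iff.2 (hz i)) (incl_mem_punctured _), step_incl]
  have h := norm_add_sq_eq_norm_sq_add_norm_sq_of_inner_eq_zero _ _
    (inner_tangent (proj z) (-(α • grad f (proj z))) i)
  have hn : ‖(proj z i : EuclideanSpace ℝ (Fin (d i + 1))) +
      ((-(α • grad f (proj z)) : tangent (proj z)) : Ambient d) i‖ =
      √(1 + α ^ 2 * ‖gradExt f z i‖ ^ 2) := by
    symm
    rw [Real.sqrt_eq_iff_mul_self_eq (by positivity) (norm_nonneg _), h, norm_coe]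
    simp [gradExt, norm_smul, ← sq, mul_pow]
  rw [hs, blockScale_apply, smul_comm, ← hn]
  rfl

theorem contDiffAt_rgdExt (hf : ContMDiff (model d) 𝓘(ℝ, ℝ) 2 f) (α : ℝ) {z : Ambient d}
    (hz : z ∈ punctured d) : ContDiffAt ℝ 1 (rgdExt f α) z := by
  refine (contDiffAt_piLp 2).2 fun i => ?_
  have hγ : ContDiffAt ℝ 1 (fun w => gradExt f w i) z :=
    (contDiffAt_piLp 2).1 (contDiffAt_gradExt hf hz) i
  have hs : ContDiffAt ℝ 1 (fun w => step f α w i) z :=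
    (contDiffAt_piLp 2).1 (contDiffAt_step hf α hz) i
  have h1 : ContDiffAt ℝ 1 (fun w => 1 + α ^ 2 * ‖gradExt f w i‖ ^ 2) z :=
    contDiffAt_const.add (contDiffAt_const.mul (hγ.norm_sq ℝ))
  refine (((h1.sqrt (by positivity)).inv (by positivity)).smul hs).congr_of_eventuallyEq ?_
  filter_upwards [isOpen_punctured.mem_nhds hz] with w hw
  exact rgdExt_apply α hw i

/-- The normalizing factor depends quadratically on the gradient, hence is stationary at a critical
point. -/
theorem hasFDerivAt_rgdExt (hf : ContMDiff (model d) 𝓘(ℝ, ℝ) 2 f) (α : ℝ) {x : ProductSphere d}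
    (hx : grad f x = 0) :
    HasFDerivAt (rgdExt f α)
      (ContinuousLinearMap.id ℝ (Ambient d) - α • fderiv ℝ (gradExt f) (incl x)) (incl x) := by
  have hxp := incl_mem_punctured x
  rw [← hasFDerivWithinAt_univ, hasFDerivWithinAt_piLp]
  intro i
  rw [hasFDerivWithinAt_univ]
  let p := PiLp.proj (𝕜 := ℝ) 2 (fun i : Fin N => EuclideanSpace ℝ (Fin (d i + 1))) i
  have hγ0 : gradExt f (incl x) i = 0 := by rw [gradExt_incl, hx]; rfl
  have h2 : HasFDerivAt (fun w : Ambient d => gradExt f w i)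
      (p.comp (fderiv ℝ (gradExt f) (incl x))) (incl x) :=
    p.hasFDerivAt.comp (incl x) (differentiableAt_gradExt hf hxp).hasFDerivAt
  have h4 : HasFDerivAt (fun w => step f α w i) (p.comp (fderiv ℝ (step f α) (incl x))) (incl x) :=
    p.hasFDerivAt.comp (incl x)
      ((contDiffAt_step hf α hxp).differentiableAt one_ne_zero).hasFDerivAt
  have h5 : HasFDerivAt (fun w => 1 + α ^ 2 * ‖gradExt f w i‖ ^ 2)
      (0 : Ambient d →L[ℝ] ℝ) (incl x) := by
    refine ((h2.norm_sq.const_mul (α ^ 2)).const_add 1).congr_fderiv ?_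
    ext v
    simp [hγ0]
  have h6 : HasFDerivAt (fun w => (√(1 + α ^ 2 * ‖gradExt f w i‖ ^ 2))⁻¹)
      (0 : Ambient d →L[ℝ] ℝ) (incl x) := by
    have := (hasDerivAt_inv (x := √(1 + α ^ 2 * ‖gradExt f (incl x) i‖ ^ 2))
      (by positivity)).comp_hasFDerivAt (incl x) (h5.sqrt (by positivity))
    refine this.congr_fderiv ?_
    simp
  refine ((h6.smul h4).congr_fderiv ?_).congr_of_eventuallyEq ?_
  · ext v : 1
    have := fderiv_step_incl_apply hf α x v i
    simp [hx] at this
    simp [hγ0, p, this]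
  · filter_upwards [isOpen_punctured.mem_nhds hxp] with w hw
    exact rgdExt_apply α hw i

/-- At a critical point the factors `‖z i‖` do not affect the derivative at `incl x`, so it is that
of the Euclidean gradient of `f ∘ proj`, symmetric by Schwarz. -/
theorem isSymmetric_fderiv_gradExt (hf : ContMDiff (model d) 𝓘(ℝ, ℝ) 2 f) {x : ProductSphere d}
    (hx : grad f x = 0) (u v : Ambient d) :
    inner ℝ (fderiv ℝ (gradExt f) (incl x) u) v = inner ℝ u (fderiv ℝ (gradExt f) (incl x) v) := by
  have hxp := incl_mem_punctured x
  set ψ : Ambient d → Ambient d := gradient fun w => f (proj w) with hψ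
  have hψd : HasFDerivAt ψ (fderiv ℝ ψ (incl x)) (incl x) :=
    ((contDiffAt_gradient_comp_proj hf hxp).differentiableAt one_ne_zero).hasFDerivAt
  have hψ0 : ψ (incl x) = 0 := by
    rw [hψ, gradient_comp_proj hf hxp, gradExt_incl, hx]
    simp
  have hΓ : fderiv ℝ (gradExt f) (incl x) = fderiv ℝ ψ (incl x) := by
    refine HasFDerivAt.fderiv ?_
    rw [← hasFDerivWithinAt_univ, hasFDerivWithinAt_piLp]
    intro i
    rw [hasFDerivWithinAt_univ]
    let p := PiLp.proj (𝕜 := ℝ) 2 (fun i : Fin N => EuclideanSpace ℝ (Fin (d i + 1))) i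
    have h0 : HasFDerivAt (fun w : Ambient d => ‖w i‖)
        (fderiv ℝ (fun w : Ambient d => ‖w i‖) (incl x)) (incl x) :=
      ((contDiffAt_norm_apply (n := 1) hxp i).differentiableAt one_ne_zero).hasFDerivAt
    have h1 : HasFDerivAt (fun w => ψ w i) (p.comp (fderiv ℝ ψ (incl x))) (incl x) :=
      p.hasFDerivAt.comp (incl x) hψd
    refine ((h0.smul h1).congr_fderiv ?_).congr_of_eventuallyEq ?_
    · ext v : 1
      simp [hψ0, incl_apply, p]
    · filter_upwards [isOpen_punctured.mem_nhds hxp] with w hw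
      change _ = ‖w i‖ • ψ w i
      rw [hψ, gradient_comp_proj hf hw, blockScale_apply, smul_smul,
        mul_inv_cancel₀ (norm_ne_zero_iff.2 (hw i)), one_smul]
  have hF : HasFDerivAt (fderiv ℝ fun w => f (proj w))
      (fderiv ℝ (fderiv ℝ fun w => f (proj w)) (incl x)) (incl x) :=
    (((contDiffAt_comp_proj hf hxp).fderiv_right (m := 1)
      (by norm_num [one_add_one_eq_two])).differentiableAt one_ne_zero).hasFDerivAt
  have hin : ∀ a b, inner ℝ (fderiv ℝ ψ (incl x) a) b =
      fderiv ℝ (fderiv ℝ fun w => f (proj w)) (incl x) a b := by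
    intro a b
    have h1 := (innerSL ℝ b).hasFDerivAt.comp (incl x) hψd
    have h2 := hF.clm_apply (hasFDerivAt_const b (incl x))
    have h3 : (fun w => fderiv ℝ (fun w => f (proj w)) w b) = innerSL ℝ b ∘ ψ := by
      funext w
      rw [Function.comp, innerSL_apply_apply, real_inner_comm]
      simp [hψ, gradient]
    rw [h3] at h2
    have := DFunLike.congr_fun (h1.unique h2) a
    simp at this
    rw [← this, real_inner_comm]
  have hsymm := (contDiffAt_comp_proj hf hxp).isSymmSndFDerivAt (by simp)
  rw [hΓ, real_inner_comm (fderiv ℝ ψ (incl x) v) u, hin, hin]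
  exact hsymm u v

theorem fderiv_gradExt_mem_tangent (hf : ContMDiff (model d) 𝓘(ℝ, ℝ) 2 f) {x : ProductSphere d}
    (hx : grad f x = 0) (u : Ambient d) : fderiv ℝ (gradExt f) (incl x) u ∈ tangent x := fun i => by
  rw [inner_fderiv_gradExt hf, hx]
  simp

/-- The operator kills normal directions and has tangent values, so only the tangential part of `u`
matters. -/
theorem inner_fderiv_gradExt_le (hf : ContMDiff (model d) 𝓘(ℝ, ℝ) 2 f) {L : ℝ} (hL : 0 ≤ L)
    (hfL : GradLipschitz f L) {x : ProductSphere d} (hx : grad f x = 0) (u : Ambient d) :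
    inner ℝ (fderiv ℝ (gradExt f) (incl x) u) u ≤ L * ‖u‖ ^ 2 := by
  have h1 := inner_fderiv_gradExt_self_le hf hfL x (tangentPart x u)
  rw [fderiv_gradExt_tangentPart hf,
    inner_tangentPart x ⟨_, fderiv_gradExt_mem_tangent hf hx u⟩ u] at h1
  refine h1.trans ?_
  have h2 : ‖(tangentPart x u : Ambient d)‖ ≤ ‖u‖ := by
    have h3 := inner_tangentPart x (tangentPart x u) u
    rw [real_inner_self_eq_norm_sq] at h3
    have h4 := real_inner_le_norm (tangentPart x u : Ambient d) u
    by_contra! h5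
    nlinarith [norm_nonneg u]
  gcongr

/-! ### Almost every orbit leaves a strict saddle -/

theorem exists_nhds_measure_rgdExt_eq_zero (hf : ContMDiff (model d) 𝓘(ℝ, ℝ) 2 f) {L : ℝ}
    (hL : 0 ≤ L) (hfL : GradLipschitz f L) {α : ℝ} (hα : 0 < α) (hαL : α * L < 1)
    (μ : MeasureTheory.Measure (Ambient d)) [μ.IsAddHaarMeasure] {x : ProductSphere d}
    (hx : IsStrictSaddle f x) :
    ∃ U ∈ 𝓝 (incl x), μ {z | ∀ t, (rgdExt f α)^[t] z ∈ U} = 0 := by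
  obtain ⟨hx0, c, hc, hec⟩ := hx
  obtain ⟨v, hv⟩ := hec.exists_hasEigenvector
  have hv1 : hess f x v = c • v := hv.apply_eq_smul
  have hv2 : fderiv ℝ (gradExt f) (incl x) (v : Ambient d) = c • (v : Ambient d) := by
    -- The derivative already takes tangent values here, so the projection in `hess` disappears.
    have h := congrArg (fun w : tangent x => (w : Ambient d)) hv1
    simp only [hess_eq hf] at h
    rw [← Submodule.starProjection_apply] at h
    rwa [(tangent x).starProjection_eq_self_iff.2 (fderiv_gradExt_mem_tangent hf hx0 _)] at h
  refine exists_nhds_measure_forall_iterate_mem_eq_zero μ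
    ((contDiffAt_rgdExt hf α (incl_mem_punctured x)).hasStrictFDerivAt'
      (hasFDerivAt_rgdExt hf α hx0) one_ne_zero) ?_ ?_ (m := 1 - α * c) ?_
    (e := (v : Ambient d)) ?_ ?_
  · intro u w
    simp [inner_sub_left, inner_sub_right, inner_smul_left, inner_smul_right,
      isSymmetric_fderiv_gradExt hf hx0 u w]
  · intro u
    have h := inner_fderiv_gradExt_le hf hL hfL hx0 u
    simp only [sub_apply, smul_apply,
      ContinuousLinearMap.id_apply, inner_sub_left, inner_smul_left, conj_trivial,
      real_inner_self_eq_norm_sq]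
    nlinarith [sq_nonneg ‖u‖]
  · nlinarith
  · simpa using hv.2
  · simp [hv2, sub_smul, mul_smul]

theorem exists_nhds_measure_trapped_eq_zero (hf : ContMDiff (model d) 𝓘(ℝ, ℝ) 2 f) {L : ℝ}
    (hL : 0 ≤ L) (hfL : GradLipschitz f L) {α : ℝ} (hα : 0 < α) (hαL : α * L < 1)
    (μ : MeasureTheory.Measure (Ambient d)) [μ.IsAddHaarMeasure] {x : ProductSphere d}
    (hx : IsStrictSaddle f x) :
    ∃ V ∈ 𝓝 x, μ (punctured d ∩ proj ⁻¹' {y | ∀ t, (rgd f α)^[t] y ∈ V}) = 0 := by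
  obtain ⟨U, hU, hU0⟩ := exists_nhds_measure_rgdExt_eq_zero hf hL hfL hα hαL μ hx
  have hcont : Continuous fun p : (Fin N → ℝ) × ProductSphere d => blockScale p.1 (incl p.2) := by
    refine (PiLp.continuous_toLp 2 _).comp (continuous_pi fun i => ?_)
    exact ((continuous_apply i).comp continuous_fst).smul
      (continuous_subtype_val.comp ((continuous_apply i).comp continuous_snd))
  have h1 : blockScale (fun _ => 1) (incl x) = incl x := by ext i : 1; simp
  have hpre := hcont.continuousAt (x := ((fun _ => 1), x)) (by rw [h1]; exact hU)
  rw [Filter.mem_map, nhds_prod_eq, Filter.mem_prod_iff] at hpre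
  -- Norms in `S` persist under iteration, so for them being trapped in `V` forces the lifted orbit
  -- to stay in `U`.
  obtain ⟨S, hS, V, hV, hSV⟩ := hpre
  refine ⟨V, hV, ?_⟩
  set K := {y | ∀ t, (rgd f α)^[t] y ∈ V}
  have hnull : μ {z | z ∈ punctured d ∧ (fun i => ‖z i‖) ∈ S ∧ proj z ∈ K} = 0 := by
    refine MeasureTheory.measure_mono_null ?_ hU0
    rintro z ⟨hz, hzS, hzK⟩ t
    rw [iterate_rgdExt α hz]
    exact hSV (Set.mk_mem_prod hzS (hzK t))
  -- Near any point of the cone, scaling by the inverse norms brings the norms into `S`.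
  refine MeasureTheory.measure_null_of_locally_null _ fun z hz => ?_
  have hc : ∀ i, 0 < ‖z i‖⁻¹ := fun i => inv_pos.2 (norm_pos_iff.2 (hz.1 i))
  have hcont2 : Continuous fun w : Ambient d => fun i => ‖blockScale (fun i => ‖z i‖⁻¹) w i‖ :=
    continuous_pi fun i => ((PiLp.continuous_apply 2 _ i).comp
      (blockScale (fun i => ‖z i‖⁻¹)).continuous).norm
  have hone : (fun i => ‖blockScale (fun i => ‖z i‖⁻¹) z i‖) = fun _ => 1 := by
    funext i
    rw [← incl_proj hz.1, incl_apply, norm_coe]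
  have hnhds := hcont2.continuousAt (x := z) (by rw [hone]; exact hS)
  refine ⟨_, Filter.inter_mem (mem_nhdsWithin_of_mem_nhds hnhds) self_mem_nhdsWithin, ?_⟩
  refine MeasureTheory.measure_mono_null ?_
    (MeasureTheory.addHaar_image_eq_zero_of_differentiableOn_of_addHaar_eq_zero μ
      (blockScale fun i => ‖z i‖).differentiableOn hnull)
  rintro w ⟨hwS, hw, hwK⟩
  refine ⟨blockScale (fun i => ‖z i‖⁻¹) w, ⟨blockScale_mem_punctured hc hw, hwS, ?_⟩, ?_⟩
  · rw [proj_blockScale hc hw]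
    exact hwK
  · ext i : 1
    rw [blockScale_apply, blockScale_apply, smul_smul,
      mul_inv_cancel₀ (norm_ne_zero_iff.2 (hz.1 i)), one_smul]

/-! ### From null cones to measure zero, and iterated preimages -/

open MeasureTheory

/-- A subset of the product of spheres has measure zero if the cone over it is null. -/
theorem measureZero_of_measure_cone_eq_zero {A : Set (ProductSphere d)}
    (hA : ∀ μ : Measure (Ambient d), μ.IsAddHaarMeasure → μ (punctured d ∩ proj ⁻¹' A) = 0) :
    MeasureZero A := by
  intro φ hφ
  let H := (∀ i : Fin N, EuclideanSpace ℝ (Fin (d i))) × (Fin N → ℝ)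
  have hrank : Module.finrank ℝ H = Module.finrank ℝ (Ambient d) := by
    rw [(WithLp.linearEquiv 2 ℝ (∀ i : Fin N, EuclideanSpace ℝ (Fin (d i + 1)))).finrank_eq]
    simp [H, Module.finrank_pi_fintype, Finset.sum_add_distrib]
  let Λ : H ≃L[ℝ] Ambient d := ContinuousLinearEquiv.ofFinrankEq hrank
  let ν : Measure H := volume.prod volume
  have h1 : (volume : Measure (∀ i : Fin N, EuclideanSpace ℝ (Fin (d i)))).IsAddHaarMeasure :=
    inferInstanceAs (Measure.pi fun _ => volume).IsAddHaarMeasure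
  have hν : ν.IsAddHaarMeasure := Measure.prod.instIsAddHaarMeasure volume volume
  let μ : Measure (Ambient d) := ν.map Λ
  have hμ : μ.IsAddHaarMeasure := Λ.isAddHaarMeasure_map ν
  -- Polar coordinates: the cone over `A ∩ φ.source` goes onto its chart image times `(0, ∞)^N`. `Λ`
  -- identifies the two spaces of equal dimension.
  let F : Ambient d → H := fun z => (φ.extend (model d) (proj z), fun i => ‖z i‖)
  have hF : DifferentiableOn ℝ F (punctured d ∩ proj ⁻¹' (A ∩ φ.source)) := by
    rintro z ⟨hz, -, hzφ⟩
    refine DifferentiableAt.differentiableWithinAt (DifferentiableAt.prodMk ?_ ?_)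
    · have h1 := φ.contMDiffAt_extend hφ hzφ
      have h2 := ContMDiffAt.comp z h1 (contMDiffAt_proj hz)
      exact (contMDiffAt_iff_contDiffAt.1 h2).differentiableAt (by simp)
    · exact differentiableAt_pi.2 fun i =>
        (contDiffAt_norm_apply (n := 1) hz i).differentiableAt one_ne_zero
  have himage : μ ((fun z => Λ (F z)) '' (punctured d ∩ proj ⁻¹' (A ∩ φ.source))) = 0 :=
    addHaar_image_eq_zero_of_differentiableOn_of_addHaar_eq_zero μ
      (Λ.differentiable.comp_differentiableOn hF)
      (measure_mono_null (Set.inter_subset_inter_right _ (Set.preimage_mono Set.inter_subset_left))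
        (hA μ hμ))
  have hνF : ν (F '' (punctured d ∩ proj ⁻¹' (A ∩ φ.source))) = 0 := by
    refine measure_mono_null ?_
      (le_zero_iff.1 ((Measure.le_map_apply Λ.continuous.aemeasurable _).trans himage.le))
    rintro _ ⟨z, hz, rfl⟩
    exact ⟨z, hz, rfl⟩
  have hprod : ν ((φ.extend (model d) '' (A ∩ φ.source)) ×ˢ
      (Set.univ.pi fun _ : Fin N => Set.Ioi (0 : ℝ))) = 0 := by
    refine measure_mono_null ?_ hνF
    rintro ⟨a, c⟩ ⟨⟨y, hy, rfl⟩, hc⟩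
    have hc' : ∀ i, 0 < c i := fun i => hc i trivial
    have hp : proj (blockScale c (incl y)) = y := by
      rw [proj_blockScale hc' (incl_mem_punctured y), proj_incl]
    refine ⟨blockScale c (incl y),
      ⟨blockScale_mem_punctured hc' (incl_mem_punctured y), by rwa [Set.mem_preimage, hp]⟩,
      Prod.ext (congrArg (φ.extend (model d)) hp) (funext fun i => ?_)⟩
    change ‖c i • (y i : EuclideanSpace ℝ (Fin (d i + 1)))‖ = c i
    simp [norm_smul, abs_of_pos (hc' i)]
  rw [Measure.prod_prod, mul_eq_zero] at hprod
  refine hprod.resolve_right (IsOpen.measure_ne_zero _ (isOpen_set_pi Set.finite_univ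
    fun _ _ => isOpen_Ioi) ⟨fun _ => 1, fun _ _ => one_pos (α := ℝ)⟩)

theorem measure_preimage_iterate_rgd_eq_zero (hf : ContMDiff (model d) 𝓘(ℝ, ℝ) 2 f) {L : ℝ}
    (hfL : GradLipschitz f L) {α : ℝ} (hα : 0 < α) (hαL : α * L < 1)
    (μ : Measure (Ambient d)) [μ.IsAddHaarMeasure] {A : Set (ProductSphere d)}
    (hA : μ (punctured d ∩ proj ⁻¹' A) = 0) (t : ℕ) :
    μ (punctured d ∩ proj ⁻¹' ((rgd f α)^[t] ⁻¹' A)) = 0 := by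
  induction t with
  | zero => exact hA
  | succ t ih =>
    rw [Function.iterate_succ, Set.preimage_comp]
    exact measure_preimage_rgd_eq_zero hf hfL hα hαL μ ih

end ProductSphere

end

theorem mainTheorem7 {N : ℕ} (d : Fin N → ℕ) (f : ProductSphere d → ℝ)
    (hf : ContMDiff (ProductSphere.model d) 𝓘(ℝ, ℝ) 2 f)
    (L : ℝ) (hL : 0 < L) (hfL : ProductSphere.GradLipschitz f L)
    (α : ℝ) (hα : 0 < α) (hαL : α < 1 / L) :
    ProductSphere.Avoids (ProductSphere.rgd f α) {x | ProductSphere.IsStrictSaddle f x} := by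
  rw [lt_div_iff₀ hL] at hαL
  refine ProductSphere.measureZero_of_measure_cone_eq_zero fun μ hμ => ?_
  have hloc := fun x : {x | ProductSphere.IsStrictSaddle f x} =>
    ProductSphere.exists_nhds_measure_trapped_eq_zero hf hL.le hfL hα hαL μ x.2
  choose V hV hV0 using hloc
  -- Lindelöf: there may be uncountably many strict saddles.
  obtain ⟨s, hs, hcover⟩ := TopologicalSpace.countable_cover_nhds
    (α := {x | ProductSphere.IsStrictSaddle f x})
    (f := fun x => Subtype.val ⁻¹' interior (V x))
    fun x => continuous_subtype_val.continuousAt (interior_mem_nhds.2 (hV x))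
  refine MeasureTheory.measure_mono_null ?_ ((MeasureTheory.measure_biUnion_null_iff hs).2
    fun x _ => MeasureTheory.measure_iUnion_null fun T : ℕ =>
      ProductSphere.measure_preimage_iterate_rgd_eq_zero hf hfL hα hαL μ (hV0 x) T)
  rintro z ⟨hz, y, hy, hlim⟩
  have hmem : (⟨y, hy⟩ : {x | ProductSphere.IsStrictSaddle f x}) ∈
      ⋃ x ∈ s, Subtype.val ⁻¹' interior (V x) := hcover ▸ Set.mem_univ _
  simp only [Set.mem_iUnion, Set.mem_preimage] at hmem
  obtain ⟨x, hxs, hxy⟩ := hmem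
  obtain ⟨T, hT⟩ := Filter.eventually_atTop.1
    (hlim.eventually (isOpen_interior.mem_nhds hxy))
  simp only [Set.mem_iUnion]
  refine ⟨x, hxs, T, hz, fun t => ?_⟩
  rw [← Function.iterate_add_apply]
  exact interior_subset (hT _ (by omega))
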